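/- Conventions. An ideal $I$ of a commutative ring $R$ is $k$-absorbing ($k\ge 1$) if for all $x_1,\dots,x_{k+1}\in R$ with $x_1\cdots x_{k+1}\in I$ there is an $i$ such that $\prod_{j\ne i}x_j\in I$. $\textnormal{AF-dim}(R)$ is the least positive integer $k$ such that every proper ideal of $R$ is a finite product of $k$-absorbing ideals of $R$, and $\textnormal{AF-dim}(R)=\infty$ if no such $k$ exists. For a square-free integer $n\neq 1$, put $\omega_n=\frac{1+\sqrt n}{2}$ and $d_n=n$ if $n\equiv 1\pmod 4$, and $\omega_n=\sqrt n$ and $d_n=4n$ otherwise. For an integer $a$ and a prime $p$, the Kronecker symbol $\left(\frac{a}{p}\right)$ is the Legendre symbol if $p$ is odd, while $\left(\frac{a}{2}\right)$ is $0$ if $a$ is even, $1$ if $a\equiv\pm1\pmod 8$, and $-1$ if $a\equiv\pm3\pmod 8$. Theorem. Let $n\neq 1$ be a square-free integer, let $r>1$ be an integer with prime factorization $r=p_1^{a_1}\cdots p_m^{a_m}$ (the $p_i$ distinct primes, $a_i\ge 1$), and let $R=\mathbb{Z}[r\omega_n]\subseteq\mathbb{Q}(\sqrt n)$. (1) $\textnormal{AF-dim}(R)<\infty$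 if and only if $\left(\frac{d_n}{p_i}\right)\neq 1$ for every $i\in\{1,\dots,m\}$. (2) Suppose that $\textnormal{AF-dim}(R)<\infty$, and let $\mathcal F_1=\{i : \left(\frac{d_n}{p_i}\right)=0\}$ and $\mathcal F_2=\{i : \left(\frac{d_n}{p_i}\right)=-1\}$. Then $$\textnormal{AF-dim}(R)=\max\Big(\{2a_i+1 : i\in\mathcal F_1\}\cup\{2a_i : i\in\mathcal F_2\}\Big).$$ -/

import Mathlib

/-- An ideal `I` of a commutative ring is `n`-absorbing if whenever a product of `n + 1` elements
lies in `I`, the product of some `n` of them (all but the `i`-th) already lies in `I`. -/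
def IsNAbsorbing {R : Type*} [CommRing R] (n : ℕ) (I : Ideal R) : Prop :=
  ∀ a : Fin (n + 1) → R, ∏ j, a j ∈ I → ∃ i, ∏ j ∈ Finset.univ.erase i, a j ∈ I

/-- Every proper ideal of `R` is a finite product of `n`-absorbing ideals of `R`. -/
def HasAbsorbingFactorization (R : Type*) [CommRing R] (n : ℕ) : Prop :=
  ∀ I : Ideal R, I ≠ ⊤ → ∃ s : Multiset (Ideal R), (∀ J ∈ s, IsNAbsorbing n J) ∧ s.prod = I

/-- `AF-dim R`: the least positive integer `n` such that every proper ideal of `R` is a finite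
product of `n`-absorbing ideals, and `∞` (that is, `⊤`) if there is no such `n`. -/
noncomputable def AFdim (R : Type*) [CommRing R] : ℕ∞ :=
  ⨅ (n : ℕ) (_ : 1 ≤ n ∧ HasAbsorbingFactorization R n), (n : ℕ∞)

/-- `ℚ(√n) = ℚ[X]/(X² - n)`, with elements `x + y √n` for `x y : ℚ`; a field when `n` is not
the square of an integer, in particular when `n ≠ 1` is square-free. -/
abbrev QuadField (n : ℤ) : Type := QuadraticAlgebra ℚ (n : ℚ) 0

/-- The element `√n` of `ℚ(√n)`. -/
def sqrtElt (n : ℤ) : QuadField n := QuadraticAlgebra.omega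

/-- `ω_n = (1 + √n) / 2` if `n ≡ 1 (mod 4)`, and `ω_n = √n` otherwise. -/
def omegaElt (n : ℤ) : QuadField n :=
  if n % 4 = 1 then (1 / 2 : ℚ) • (1 + sqrtElt n) else sqrtElt n

/-- The order `ℤ[r ω_n]`, the subring of `ℚ(√n)` generated by `r ω_n`. -/
abbrev quadOrder (n : ℤ) (r : ℕ) : Subalgebra ℤ (QuadField n) :=
  Algebra.adjoin ℤ {(r : QuadField n) * omegaElt n}

/-- The discriminant `d_n` of `ℚ(√n)`, for `n` square-free. -/
def quadDisc (n : ℤ) : ℤ := if n % 4 = 1 then n else 4 * n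

open Classical in
/-- The Kronecker symbol `(a / p)` of an integer `a` at a prime number `p`. -/
noncomputable def kroneckerSymbol (a : ℤ) (p : ℕ) : ℤ :=
  if p = 2 then
    if a % 2 = 0 then 0
    else if a % 8 = 1 ∨ a % 8 = 7 then 1
    else -1
  else
    if (p : ℤ) ∣ a then 0
    else if ∃ x : ℤ, x ^ 2 ≡ a [ZMOD p] then 1
    else -1

/-! ### Absorbing ideals and factorizations in general rings. -/

section Absorbing

variable {R : Type*} [CommRing R]

/-! Write ω² = A + Bω for ω = ω_n, and let g(z) = z² + Bz − A be the norm of z + ω. The order is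
modelled by `QuadraticAlgebra ℤ (r²A) (rB)`. For a prime p ∣ r, the elements with rational part
divisible by p form the only prime P above p, and P² ⊆ pP (`exists_mul_eq_algebraMap_mul`).

Upper bound (`QuadraticAlgebra.hasAbsorbingFactorization`): by Noetherian induction and coprime
splitting, I may be assumed to contain a power of one prime p. If p ∤ r, the primes above p are
invertible and split off. If p ∣ r and I ⊆ pP, the factor (p) splits off. Otherwise I contains some
x in P \ pP, and p^(k+1) ∤ N(x) forces p^(k-1)P ⊆ I, which makes I k-absorbing.

Lower bound (`le_of_hasAbsorbingFactorization`): let x ∈ P have imaginary part prime to p and p^N ∣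
N(x). The ideal (x, p^N) is not inside (p), so it is not a product of two proper ideals and must
itself be k-absorbing. It then contains p^k, which forces N ≤ k.

Hence p contributes the largest p-valuation of a norm on P \ pP. With p^a exactly dividing r, this
is 2a plus the supremum of v_p(g(z)), and that supremum is 0, 1 or ∞ for p inert, ramified or split.
-/

theorem Ideal.IsPrime.isNAbsorbing {I : Ideal R} (hI : I.IsPrime) {k : ℕ} (hk : 1 ≤ k) :
    IsNAbsorbing k I := by
  intro a ha
  obtain ⟨j, -, hj⟩ := hI.prod_mem_iff.1 ha
  have : Nontrivial (Fin (k + 1)) := Fin.nontrivial_iff_two_le.2 (by omega)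
  obtain ⟨i, hi⟩ := exists_ne j
  exact ⟨i, Ideal.mem_of_dvd _ (Finset.dvd_prod_of_mem a (by simp [hi.symm])) hj⟩

/-- In a Noetherian ring, absorbing factorizations exist as soon as each ideal that is not
absorbing is a product of two strictly larger ideals. -/
theorem hasAbsorbingFactorization_of_exists_mul [IsNoetherianRing R] {k : ℕ}
    (H : ∀ I : Ideal R, I ≠ ⊤ → ¬ IsNAbsorbing k I → ∃ J K, I < J ∧ I < K ∧ J * K = I) :
    HasAbsorbingFactorization R k := by
  intro I
  induction I using WellFoundedGT.induction with
  | ind I ih =>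
    intro hI
    by_cases hk : IsNAbsorbing k I
    · exact ⟨{I}, by simpa using hk, by simp⟩
    obtain ⟨J, K, hJ, hK, h⟩ := H I hI hk
    have hJt : J ≠ ⊤ := by
      rintro rfl
      rw [Ideal.top_mul] at h
      exact hK.ne h.symm
    have hKt : K ≠ ⊤ := by
      rintro rfl
      rw [Ideal.mul_top] at h
      exact hJ.ne h.symm
    obtain ⟨s, hs, rfl⟩ := ih J hJ hJt
    obtain ⟨t, ht, rfl⟩ := ih K hK hKt
    refine ⟨s + t, fun L hL => ?_, by rw [Multiset.prod_add, h]⟩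
    rcases Multiset.mem_add.1 hL with hL | hL
    exacts [hs L hL, ht L hL]

/-- A nonzero ideal contained in an invertible proper ideal `Q` is `Q` times a strictly larger
ideal. -/
theorem Ideal.exists_eq_mul_of_le_of_mul_eq_span [IsDomain R] [IsNoetherianRing R]
    {I Q Q' : Ideal R} {z : R} (hz : z ≠ 0) (hQ : Q ≠ ⊤) (h : Q * Q' = span {z}) (hI : I ≤ Q)
    (hI0 : I ≠ ⊥) : ∃ J, I < J ∧ Q * J = I := by
  have hle : Q' * I ≤ span {z} := by
    rw [← h, mul_comm Q]
    exact Ideal.mul_mono_right hI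
  obtain ⟨J, hJ⟩ : ∃ J, span {z} * J = Q' * I := by
    -- J is Q⁻¹I = z⁻¹Q'I, which is integral because Q'I ⊆ QQ' = (z).
    refine ⟨Submodule.comap (LinearMap.mulLeft R z) (Q' * I), le_antisymm ?_ ?_⟩
    · rw [Ideal.span_singleton_mul_le_iff]
      exact fun y hy => hy
    · rw [Ideal.le_span_singleton_mul_iff]
      intro y hy
      obtain ⟨c, rfl⟩ := Ideal.mem_span_singleton'.1 (hle hy)
      exact ⟨c, by simpa [mul_comm] using hy, mul_comm _ _⟩
  have hQJ : Q * J = I := by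
    apply Ideal.span_singleton_mul_right_injective hz
    change span {z} * (Q * J) = span {z} * I
    rw [mul_left_comm, hJ, ← h, mul_assoc]
  refine ⟨J, lt_of_le_of_ne (hQJ ▸ Ideal.mul_le_right) ?_, hQJ⟩
  rintro rfl
  -- Nakayama: QI = I gives an element congruent to 1 modulo Q that kills I, impossible in a domain.
  obtain ⟨x, hx, hx0⟩ := Submodule.exists_sub_one_mem_and_smul_eq_zero_of_fg_of_le_smul Q I
    (IsNoetherian.noetherian I) hQJ.ge
  obtain ⟨y, hy, hy0⟩ := Submodule.exists_mem_ne_zero_of_ne_bot hI0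
  have h0 : x = 0 := (mul_eq_zero.1 (hx0 y hy)).resolve_right hy0
  rw [h0, zero_sub, Ideal.neg_mem_iff] at hx
  exact hQ ((Ideal.eq_top_iff_one _).2 hx)

/-- The product of finitely many ideals is one of them, or trivial, or a product of two proper
ideals. -/
theorem Ideal.multiset_prod_mem_or (s : Multiset (Ideal R)) :
    s.prod = ⊤ ∨ s.prod ∈ s ∨ ∃ J K : Ideal R, J ≠ ⊤ ∧ K ≠ ⊤ ∧ s.prod = J * K := by
  induction s using Multiset.induction with
  | empty => simp
  | cons J s ih =>
    rw [Multiset.prod_cons]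
    by_cases hJ : J = ⊤
    · subst hJ
      rw [Ideal.top_mul]
      rcases ih with h | h | h
      exacts [.inl h, .inr (.inl (Multiset.mem_cons_of_mem h)), .inr (.inr h)]
    by_cases hs : s.prod = ⊤
    · rw [hs, Ideal.mul_top]
      exact .inr (.inl (Multiset.mem_cons_self _ _))
    · exact .inr (.inr ⟨J, s.prod, hJ, hs, rfl⟩)

/-- If an absorbing ideal contains a power of `x`, it contains the `k`-th power. -/
theorem IsNAbsorbing.pow_mem {k : ℕ} {I : Ideal R} (h : IsNAbsorbing k I) {x : R} {m : ℕ}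
    (hx : x ^ m ∈ I) : x ^ k ∈ I := by
  induction m with
  | zero =>
    rw [pow_zero] at hx
    simp [(Ideal.eq_top_iff_one I).2 hx]
  | succ m ih =>
    by_cases hm : m < k
    · exact I.pow_mem_of_pow_mem hx hm
    -- Split x^(m+1) into x^(m+1-k) and k copies of x: dropping one factor leaves x^k or x^m.
    obtain ⟨i, hi⟩ := h (Fin.cons (x ^ (m + 1 - k)) fun _ => x) (by
      rw [Fin.prod_univ_succ]
      simpa [← pow_add, show m + 1 - k + k = m + 1 by omega] using hx)
    rcases Fin.eq_zero_or_eq_succ i with rfl | ⟨j, rfl⟩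
    · have : (Finset.univ.erase (0 : Fin (k + 1))) = Finset.univ.map (Fin.succEmb k) := by
        ext i; refine Fin.cases ?_ ?_ i <;> simp
      rw [this, Finset.prod_map] at hi
      simpa using hi
    · apply ih
      have h1 := Finset.mul_prod_erase (Finset.univ.erase j.succ)
        (Fin.cons (x ^ (m + 1 - k)) fun _ => x : Fin (k + 1) → R) (a := 0)
        (by simp [(Fin.succ_ne_zero j).symm])
      rw [← h1, Finset.prod_congr rfl (g := fun _ => x) (fun i hi => ?_), Finset.prod_const] at hi
      · rw [Finset.card_erase_of_mem (by simp [(Fin.succ_ne_zero j).symm]),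
          Finset.card_erase_of_mem (by simp), Finset.card_univ, Fintype.card_fin, Fin.cons_zero, ← pow_add] at hi
        have := j.pos
        rwa [show m + 1 - k + (k + 1 - 1 - 1) = m by omega] at hi
      · obtain ⟨t, rfl⟩ := Fin.exists_succ_eq.2 (Finset.ne_of_mem_erase hi)
        simp

variable {R' : Type*} [CommRing R']

theorem IsNAbsorbing.map_ringEquiv {k : ℕ} {I : Ideal R} (h : IsNAbsorbing k I) (e : R ≃+* R') :
    IsNAbsorbing k (I.map e) := by
  intro a ha
  obtain ⟨x, hx, hxa⟩ := (Ideal.mem_map_of_equiv e _).1 ha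
  obtain ⟨i, hi⟩ := h (fun j => e.symm (a j)) (by rwa [← map_prod, ← hxa, e.symm_apply_apply])
  refine ⟨i, (Ideal.mem_map_of_equiv e _).2 ⟨_, hi, ?_⟩⟩
  simp

theorem HasAbsorbingFactorization.of_ringEquiv {k : ℕ} (h : HasAbsorbingFactorization R k)
    (e : R ≃+* R') : HasAbsorbingFactorization R' k := by
  intro I hI
  have hmap : (I.map e.symm).map e = I := by
    ext x
    simp only [Ideal.map_symm, Ideal.mem_map_of_equiv, Ideal.mem_comap]
    exact ⟨fun ⟨y, hy, h⟩ => h ▸ hy, fun hx => ⟨e.symm x, by simpa using hx, by simp⟩⟩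
  obtain ⟨s, hs, hsI⟩ := h (I.map e.symm) (by
    intro ht
    rw [ht, Ideal.map_top] at hmap
    exact hI hmap.symm)
  refine ⟨s.map (Ideal.map e), fun J hJ => ?_, ?_⟩
  · obtain ⟨L, hL, rfl⟩ := Multiset.mem_map.1 hJ
    exact (hs L hL).map_ringEquiv e
  · have := map_multiset_prod (Ideal.mapHom e) s
    rw [hsI] at this
    rw [← hmap]
    exact this.symm

theorem AFdim_congr (e : R ≃+* R') : AFdim R = AFdim R' := by
  have : ∀ k, HasAbsorbingFactorization R k ↔ HasAbsorbingFactorization R' k := fun k =>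
    ⟨fun h => h.of_ringEquiv e, fun h => h.of_ringEquiv e.symm⟩
  simp only [AFdim, this]

end Absorbing

/-! ### Quadratic orders at a prime p with p² ∣ a and p ∣ b. -/

section QuadraticOrder

open QuadraticAlgebra

variable {a b p : ℤ}

theorem Ideal.eq_top_of_algebraMap_mem_of_isCoprime {S : Type*} [CommRing S] {I : Ideal S}
    {m m' : ℤ} (h : IsCoprime m m') (hm : algebraMap ℤ S m ∈ I) (hm' : algebraMap ℤ S m' ∈ I) :
    I = ⊤ := by
  obtain ⟨u, v, huv⟩ := h
  rw [Ideal.eq_top_iff_one, ← map_one (algebraMap ℤ S), ← huv, map_add, map_mul, map_mul]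
  exact I.add_mem (I.mul_mem_left _ hm) (I.mul_mem_left _ hm')

theorem Ideal.mem_of_algebraMap_mul_mem_of_isCoprime {S : Type*} [CommRing S] {I : Ideal S}
    {m m' : ℤ} {x : S} (h : IsCoprime m m') (hm : algebraMap ℤ S m * x ∈ I)
    (hm' : algebraMap ℤ S m' ∈ I) : x ∈ I := by
  obtain ⟨u, v, huv⟩ := h
  have : x = algebraMap ℤ S u * (algebraMap ℤ S m * x) +
      algebraMap ℤ S v * x * algebraMap ℤ S m' := by
    have h1 := congrArg (algebraMap ℤ S) huv
    simp only [map_add, map_mul, map_one] at h1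
    linear_combination -x * h1
  rw [this]
  exact I.add_mem (I.mul_mem_left _ hm) (I.mul_mem_left _ hm')

theorem QuadraticAlgebra.algebraMap_norm_mem {I : Ideal (QuadraticAlgebra ℤ a b)}
    {x : QuadraticAlgebra ℤ a b} (hx : x ∈ I) : algebraMap ℤ _ x.norm ∈ I := by
  rw [algebraMap_norm_eq_mul_star]
  exact I.mul_mem_right _ hx

/-- Modulo p the norm is the square of the rational part. So elements outside P are units modulo
every power of p. -/
theorem QuadraticAlgebra.isCoprime_norm (hp : Prime p) (ha : p ∣ a) (hb : p ∣ b)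
    {x : QuadraticAlgebra ℤ a b} (hx : ¬ p ∣ x.re) (e : ℕ) : IsCoprime x.norm (p ^ e) := by
  refine IsCoprime.pow_right ((hp.coprime_iff_not_dvd.2 fun h => ?_).symm)
  obtain ⟨a', rfl⟩ := ha
  obtain ⟨b', rfl⟩ := hb
  rw [norm_def] at h
  have : p ∣ x.re * x.re := by
    have h2 : p ∣ p * (a' * x.im * x.im - b' * x.re * x.im) := dvd_mul_right _ _
    have h3 := dvd_add h h2
    ring_nf at h3 ⊢
    exact h3
  exact hx ((hp.dvd_or_dvd this).elim id id)

theorem QuadraticAlgebra.dvd_re_of_mem (hp : Prime p) (ha : p ∣ a) (hb : p ∣ b)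
    {I : Ideal (QuadraticAlgebra ℤ a b)} (hI : I ≠ ⊤) {e : ℕ} (he : algebraMap ℤ _ (p ^ e) ∈ I)
    {x : QuadraticAlgebra ℤ a b} (hx : x ∈ I) : p ∣ x.re := by
  by_contra h
  exact hI (Ideal.eq_top_of_algebraMap_mem_of_isCoprime (isCoprime_norm hp ha hb h e)
    (algebraMap_norm_mem hx) he)

/-- This is P² ⊆ pP; the hypothesis p² ∣ a keeps the rational part of the quotient divisible by p.
-/
theorem QuadraticAlgebra.exists_mul_eq_algebraMap_mul (ha : p ^ 2 ∣ a) (hb : p ∣ b)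
    {x y : QuadraticAlgebra ℤ a b} (hx : p ∣ x.re) (hy : p ∣ y.re) :
    ∃ z : QuadraticAlgebra ℤ a b, p ∣ z.re ∧ x * y = algebraMap ℤ _ p * z := by
  obtain ⟨a', rfl⟩ := ha
  obtain ⟨b', rfl⟩ := hb
  obtain ⟨x, x'⟩ := x
  obtain ⟨y, y'⟩ := y
  obtain ⟨x, rfl⟩ := hx
  obtain ⟨y, rfl⟩ := hy
  refine ⟨⟨p * (x * y + a' * x' * y'), x * y' + x' * y + b' * x' * y'⟩, dvd_mul_right _ _, ?_⟩
  ext <;> simp <;> ring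

theorem QuadraticAlgebra.exists_prod_eq_algebraMap_pow_mul (ha : p ^ 2 ∣ a)
    (hb : p ∣ b) {ι : Type*} (f : ι → QuadraticAlgebra ℤ a b) (hf : ∀ i, p ∣ (f i).re)
    {k : ℕ} (s : Finset ι) (hs : s.card = k + 1) :
    ∃ z : QuadraticAlgebra ℤ a b, p ∣ z.re ∧ ∏ i ∈ s, f i = algebraMap ℤ _ (p ^ k) * z := by
  classical
  induction k generalizing s with
  | zero =>
    obtain ⟨i, rfl⟩ := Finset.card_eq_one.1 hs
    exact ⟨f i, hf i, by simp⟩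
  | succ k ih =>
    obtain ⟨i, t, hi, rfl, ht⟩ := Finset.card_eq_succ.1 hs
    obtain ⟨z, hz, h⟩ := ih t ht
    obtain ⟨w, hw, h'⟩ := exists_mul_eq_algebraMap_mul ha hb (hf i) hz
    refine ⟨w, hw, ?_⟩
    rw [Finset.prod_insert hi, h, mul_left_comm, h', pow_succ, map_mul, mul_assoc]

/-- An ideal containing a power of `p` is `k`-absorbing if it contains `p ^ (k - 1) P`, where `P` is
the prime ideal of all elements whose rational part is divisible by `p`. -/
theorem QuadraticAlgebra.isNAbsorbing_of_forall_mem (hp : Prime p) (ha : p ^ 2 ∣ a) (hb : p ∣ b)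
    {I : Ideal (QuadraticAlgebra ℤ a b)} {e : ℕ} (he : algebraMap ℤ _ (p ^ e) ∈ I) {k : ℕ}
    (hk : 1 ≤ k)
    (h : ∀ x : QuadraticAlgebra ℤ a b, p ∣ x.re → algebraMap ℤ _ (p ^ (k - 1)) * x ∈ I) :
    IsNAbsorbing k I := by
  intro f hf
  by_cases hfp : ∀ i, p ∣ (f i).re
  · obtain ⟨z, hz, hz'⟩ := exists_prod_eq_algebraMap_pow_mul ha hb f hfp (k := k - 1)
      (Finset.univ.erase 0) (by simp [Finset.card_erase_of_mem]; omega)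
    exact ⟨0, hz' ▸ h z hz⟩
  -- A factor outside P is a unit modulo p^e and can be omitted.
  · push Not at hfp
    obtain ⟨i, hi⟩ := hfp
    refine ⟨i, Ideal.mem_of_algebraMap_mul_mem_of_isCoprime
      (isCoprime_norm hp ((dvd_pow_self p two_ne_zero).trans ha) hb hi e) ?_ he⟩
    rw [algebraMap_norm_eq_mul_star, mul_comm (f i), mul_assoc,
      Finset.mul_prod_erase _ _ (Finset.mem_univ i)]
    exact I.mul_mem_left _ hf

/-- Write N(x) = p^v u with p ∤ u. Since `star x` and y lie in P, their product is pz, so u p^(v-1)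
y = zx lies in I; u is a unit modulo p^e and v ≤ k. -/
theorem QuadraticAlgebra.algebraMap_pow_mul_mem (hp : Prime p) (ha : p ^ 2 ∣ a) (hb : p ∣ b)
    {I : Ideal (QuadraticAlgebra ℤ a b)} {e : ℕ} (he : algebraMap ℤ _ (p ^ e) ∈ I) {k : ℕ}
    {x : QuadraticAlgebra ℤ a b} (hx : x ∈ I) (hxp : p ∣ x.re) (hxn : ¬ p ^ (k + 1) ∣ x.norm)
    {y : QuadraticAlgebra ℤ a b} (hy : p ∣ y.re) : algebraMap ℤ _ (p ^ (k - 1)) * y ∈ I := by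
  have hn0 : x.norm ≠ 0 := fun h => hxn (h ▸ dvd_zero _)
  have hfin : FiniteMultiplicity p x.norm := ⟨k, hxn⟩
  obtain ⟨u, hu, hpu⟩ := hfin.exists_eq_pow_mul_and_not_dvd
  set v := multiplicity p x.norm with hv
  have hvk : v ≤ k := by
    by_contra! h
    exact hxn ((pow_dvd_pow p h).trans ⟨u, hu⟩)
  have ha' : p ∣ a := (dvd_pow_self p two_ne_zero).trans ha
  have hv0 : v ≠ 0 := by
    intro h0
    rw [h0, pow_zero, one_mul] at hu
    apply hpu
    rw [← hu, norm_def]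
    exact ((hxp.mul_right _).add ((hb.mul_right _).mul_right _)).sub ((ha'.mul_right _).mul_right _)
  have hsx : p ∣ (star x).re := hxp.add (hb.mul_right _)
  obtain ⟨z, hz, hz'⟩ := exists_mul_eq_algebraMap_mul ha hb hsx hy
  refine Ideal.mem_of_algebraMap_mul_mem_of_isCoprime
    (IsCoprime.pow_right (n := e) (hp.coprime_iff_not_dvd.2 hpu).symm) ?_ he
  have hpS : algebraMap ℤ (QuadraticAlgebra ℤ a b) p ∈ nonZeroDivisors _ :=
    algebraMap_mem_nonZeroDivisors_iff.2 (mem_nonZeroDivisors_of_ne_zero hp.ne_zero)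
  have key : algebraMap ℤ (QuadraticAlgebra ℤ a b) u * (algebraMap ℤ _ (p ^ (k - 1)) * y) =
      algebraMap ℤ _ (p ^ (k - v)) * z * x := by
    rw [← mul_cancel_left_mem_nonZeroDivisors hpS]
    have h1 : algebraMap ℤ (QuadraticAlgebra ℤ a b) p * algebraMap ℤ _ (p ^ (k - 1)) =
        algebraMap ℤ _ (p ^ (k - v)) * algebraMap ℤ _ (p ^ v) := by
      rw [← map_mul, ← map_mul, ← pow_succ', ← pow_add]
      congr 2
      omega
    have h2 := algebraMap_norm_eq_mul_star x
    rw [hu, map_mul] at h2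
    linear_combination algebraMap ℤ (QuadraticAlgebra ℤ a b) u * y * h1 +
      algebraMap ℤ (QuadraticAlgebra ℤ a b) (p ^ (k - v)) * y * h2 +
      algebraMap ℤ (QuadraticAlgebra ℤ a b) (p ^ (k - v)) * x * hz'
  rw [key]
  exact I.mul_mem_left _ hx

/-- An element of `P` with imaginary part prime to `p` and norm divisible by `p ^ N` forces
`N ≤ k` if absorbing factorizations exist. -/
theorem QuadraticAlgebra.le_of_hasAbsorbingFactorization (hp : Prime p) (ha : p ^ 2 ∣ a)
    (hb : p ∣ b) {k : ℕ} (hk : HasAbsorbingFactorization (QuadraticAlgebra ℤ a b) k)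
    {x : QuadraticAlgebra ℤ a b} (hx : p ∣ x.re) (hx' : ¬ p ∣ x.im) {N : ℕ}
    (hN : p ^ N ∣ x.norm) : N ≤ k := by
  by_contra! hkN
  have ha' : p ∣ a := (dvd_pow_self p two_ne_zero).trans ha
  set I : Ideal (QuadraticAlgebra ℤ a b) := Ideal.span {x, algebraMap ℤ _ (p ^ N)} with hIdef
  have hxI : x ∈ I := Ideal.subset_span (by simp)
  have hNI : algebraMap ℤ _ (p ^ N) ∈ I := Ideal.subset_span (by simp)
  have hI : I ≠ ⊤ := by
    intro h
    have h1 : (1 : QuadraticAlgebra ℤ a b) ∈ I := h ▸ Submodule.mem_top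
    obtain ⟨c, d, hcd⟩ := Ideal.mem_span_pair.1 h1
    have h2 := congrArg QuadraticAlgebra.re hcd
    simp only [re_add, re_mul, algebraMap_re, algebraMap_im, mul_zero, add_zero, re_one] at h2
    apply hp.not_dvd_one
    rw [← h2]
    exact ((hx.mul_left _).add ((ha'.mul_right _).mul_right _)).add
      ((dvd_pow_self p (by omega)).mul_left _)
  obtain ⟨s, hs, hsI⟩ := hk I hI
  have hIk : IsNAbsorbing k I := by
    rcases Ideal.multiset_prod_mem_or s with h | h | ⟨J, K, hJ, hK, h⟩
    · exact absurd (hsI ▸ h) hI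
    · exact hs _ (hsI ▸ h)
    · exfalso
      rw [hsI] at h
      have hIJ : I ≤ J := h ▸ Ideal.mul_le_left
      have hIK : I ≤ K := h ▸ Ideal.mul_le_right
      have hle : I ≤ Ideal.span {algebraMap ℤ _ p} := by
        rw [h, Ideal.mul_le]
        intro y hy z hz
        obtain ⟨w, -, hw⟩ := exists_mul_eq_algebraMap_mul ha hb
          (dvd_re_of_mem hp ha' hb hJ (hIJ hNI) hy) (dvd_re_of_mem hp ha' hb hK (hIK hNI) hz)
        exact Ideal.mem_span_singleton.2 ⟨w, hw⟩
      exact hx' (algebraMap_dvd_iff.1 (Ideal.mem_span_singleton.1 (hle hxI))).2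
  have hpk : algebraMap ℤ (QuadraticAlgebra ℤ a b) p ^ k ∈ I :=
    hIk.pow_mem (m := N) (by rwa [← map_pow])
  obtain ⟨c, d, hcd⟩ := Ideal.mem_span_pair.1 hpk
  -- Multiply p^k = cx + dp^N by `star x`. After cancelling p^k, the imaginary parts modulo p give p
  -- ∣ `x.im`, because k < N.
  have hcd' : algebraMap ℤ (QuadraticAlgebra ℤ a b) (p ^ k) *
      (star x * (1 - algebraMap ℤ _ (p ^ (N - k)) * d)) = algebraMap ℤ _ x.norm * c := by
    have h1 : algebraMap ℤ (QuadraticAlgebra ℤ a b) (p ^ N) =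
        algebraMap ℤ _ (p ^ k) * algebraMap ℤ _ (p ^ (N - k)) := by
      rw [← map_mul, ← pow_add, Nat.add_sub_cancel' hkN.le]
    rw [h1, ← map_pow] at hcd
    rw [algebraMap_norm_eq_mul_star]
    linear_combination -(star x) * hcd
  obtain ⟨m, hm⟩ := hN
  have him := congrArg QuadraticAlgebra.im hcd'
  rw [← C_eq_algebraMap, C_mul_eq_smul, C_mul_eq_smul, C_mul_eq_smul, hm,
    show p ^ N = p ^ k * p ^ (N - k) by rw [← pow_add, Nat.add_sub_cancel' hkN.le]] at him
  simp only [im_smul, smul_eq_mul, mul_assoc] at him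
  have him' := mul_left_cancel₀ (pow_ne_zero k hp.ne_zero) him
  simp only [im_mul, re_star, im_star, re_sub, im_sub, re_one, im_one, re_smul, im_smul,
    smul_eq_mul] at him'
  obtain ⟨q, hq⟩ : p ∣ p ^ (N - k) := dvd_pow_self p (by omega)
  obtain ⟨b', rfl⟩ := hb
  rw [hq] at him'
  obtain ⟨x0, hx0⟩ := hx
  apply hx'
  refine ⟨- q * (m * c.im) + (x0 + b' * x.im) * (0 - p * q * d.im) + x.im * (q * d.re) +
    b' * (-x.im) * (0 - p * q * d.im), ?_⟩
  rw [hx0] at him'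
  linear_combination -him'

end QuadraticOrder

/-! ### Invertible primes, norm bounds and existence of factorizations. -/

section QuadraticOrderUpper

open QuadraticAlgebra

/-- In a quadratic order that is maximal at `p`, prime ideals containing `p` are invertible. -/
theorem QuadraticAlgebra.exists_mul_eq_span_algebraMap {a b p : ℤ} (hp : Prime p)
    (hmax : ∀ c : ℤ, p ^ 2 ∣ c ^ 2 + b * c - a → ¬ p ∣ 2 * c + b)
    {M : Ideal (QuadraticAlgebra ℤ a b)} (hM : M ≠ ⊤) (hpM : algebraMap ℤ _ p ∈ M) :
    ∃ M', M * M' = Ideal.span {algebraMap ℤ _ p} := by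
  by_cases hle : M ≤ Ideal.span {algebraMap ℤ _ p}
  · exact ⟨⊤, by rw [Ideal.mul_top]; exact le_antisymm hle (by simpa [Ideal.span_le] using hpM)⟩
  have hint : ∀ m : ℤ, algebraMap ℤ _ m ∈ M → p ∣ m := by
    intro m hm
    by_contra h
    exact hM (Ideal.eq_top_of_algebraMap_mem_of_isCoprime (hp.coprime_iff_not_dvd.2 h) hpM hm)
  obtain ⟨x, hxM, hx⟩ := SetLike.not_le_iff_exists.1 hle
  rw [Ideal.mem_span_singleton, algebraMap_dvd_iff] at hx
  have hxim : ¬ p ∣ x.im := by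
    intro h
    have : algebraMap ℤ _ x.re ∈ M := by
      obtain ⟨y, hy⟩ := h
      have : algebraMap ℤ (QuadraticAlgebra ℤ a b) x.re = x - algebraMap ℤ _ p * ⟨0, y⟩ := by
        ext <;> simp [hy]
      rw [this]
      exact M.sub_mem hxM (M.mul_mem_right _ hpM)
    exact hx ⟨hint _ this, h⟩
  -- Dividing x by its imaginary part modulo p puts t = c + ω into M, where ω is the generator; then
  -- M = (p, t).
  obtain ⟨u, v, huv⟩ := hp.coprime_iff_not_dvd.2 hxim
  set c := v * x.re with hc
  set t : QuadraticAlgebra ℤ a b := ⟨c, 1⟩ with ht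
  have htM : t ∈ M := by
    have : t = algebraMap ℤ _ v * x + algebraMap ℤ _ p * ⟨0, u⟩ := by
      ext <;> simp [ht, hc]
      linarith
    rw [this]
    exact M.add_mem (M.mul_mem_left _ hxM) (M.mul_mem_right _ hpM)
  have htn : t.norm = c ^ 2 + b * c - a := by
    simp only [norm_def, ht]
    ring
  obtain ⟨n, hn⟩ := hint _ (algebraMap_norm_mem htM)
  -- The product is p(p, t, `star t`, n), whose second factor contains p, n and t + `star t` = 2c +
  -- b. By `hmax`, p cannot divide both n and 2c + b.
  refine ⟨Ideal.span {algebraMap ℤ _ p, star t}, le_antisymm ?_ ?_⟩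
  · rw [Ideal.mul_le]
    intro y hy z hz
    obtain ⟨d, d', rfl⟩ := Ideal.mem_span_pair.1 hz
    have hy' : y = algebraMap ℤ _ (y.re - y.im * c) + algebraMap ℤ _ y.im * t := by
      ext <;> simp [ht]
    have hdy : p ∣ y.re - y.im * c := by
      apply hint
      rw [← sub_eq_iff_eq_add] at hy'
      rw [← hy']
      exact M.sub_mem hy (M.mul_mem_left _ htM)
    obtain ⟨q, hq⟩ := hdy
    rw [hq] at hy'
    rw [Ideal.mem_span_singleton]
    have hnt := algebraMap_norm_eq_mul_star t
    rw [hn] at hnt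
    refine ⟨y * d + algebraMap ℤ _ q * d' * star t + algebraMap ℤ _ y.im * d' *
      algebraMap ℤ _ n, ?_⟩
    rw [map_mul] at hy' hnt
    linear_combination d' * star t * hy' - algebraMap ℤ _ y.im * d' * hnt
  · rw [Ideal.span_singleton_le_iff_mem]
    set J := M * Ideal.span {algebraMap ℤ _ p, star t}
    have h1 : algebraMap ℤ _ (p * p) ∈ J := by
      rw [map_mul]
      exact Ideal.mul_mem_mul hpM (Ideal.subset_span (by simp))
    have h2 : algebraMap ℤ _ (p * n) ∈ J := by
      rw [← hn, algebraMap_norm_eq_mul_star]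
      exact Ideal.mul_mem_mul htM (Ideal.subset_span (by simp))
    have h3 : algebraMap ℤ _ (p * (2 * c + b)) ∈ J := by
      have : algebraMap ℤ (QuadraticAlgebra ℤ a b) (p * (2 * c + b)) =
          t * algebraMap ℤ _ p + algebraMap ℤ _ p * star t := by
        ext
        · simp [ht]
          ring
        · simp [ht]
      rw [this]
      exact J.add_mem (Ideal.mul_mem_mul htM (Ideal.subset_span (by simp)))
        (Ideal.mul_mem_mul hpM (Ideal.subset_span (by simp)))
    have aux : ∀ m : ℤ, ¬ p ∣ m → algebraMap ℤ _ (p * m) ∈ J → algebraMap ℤ _ p ∈ J := by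
      intro m hm hmJ
      obtain ⟨u, v, huv⟩ := hp.coprime_iff_not_dvd.2 hm
      have : p = u * (p * p) + v * (p * m) := by linear_combination -p * huv
      rw [this, map_add, map_mul _ u, map_mul _ v]
      exact J.add_mem (J.mul_mem_left _ h1) (J.mul_mem_left _ hmJ)
    by_cases hpn : p ∣ n
    · refine aux _ (hmax c ?_) h3
      rw [← htn, hn, sq]
      exact mul_dvd_mul_left p hpn
    · exact aux _ hpn h2

/-- Norms of elements of `P` outside `p P` have bounded divisibility by `p`. -/
theorem not_pow_dvd_of_forall_not_dvd {A B p r : ℤ} (hp : Prime p) {v E : ℕ} (hv : 1 ≤ v)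
    (hr : p ^ v ∣ r) (hr' : ¬ p ^ (v + 1) ∣ r)
    (hg : ∀ z : ℤ, ¬ p ^ (E + 1) ∣ z ^ 2 + B * z - A) {x y : ℤ} (hx : p ∣ x)
    (hxy : ¬ (p ^ 2 ∣ x ∧ p ∣ y)) :
    ¬ p ^ (2 * v + E + 1) ∣ x ^ 2 + r * B * x * y - r ^ 2 * A * y ^ 2 := by
  intro h
  obtain ⟨r, rfl⟩ := hr
  by_cases hxv : p ^ v ∣ x
  · obtain ⟨x, rfl⟩ := hxv
    have h1 : p ^ (E + 1) ∣ x ^ 2 + B * x * (r * y) - A * (r * y) ^ 2 := by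
      have : p ^ (2 * v) * p ^ (E + 1) ∣
          p ^ (2 * v) * (x ^ 2 + B * x * (r * y) - A * (r * y) ^ 2) := by
        rw [← pow_add, ← add_assoc]
        convert h using 1
        ring
      exact (mul_dvd_mul_iff_left (pow_ne_zero _ hp.ne_zero)).1 this
    by_cases hy : p ∣ y
    · have h2 : p ∣ x ^ 2 := by
        have h3 := (dvd_pow_self p E.succ_ne_zero).trans h1
        obtain ⟨y, rfl⟩ := hy
        have h4 : p ∣ p * (A * r ^ 2 * p * y ^ 2 - B * x * r * y) := dvd_mul_right _ _
        have h5 := dvd_add h3 h4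
        ring_nf at h5 ⊢
        exact h5
      refine hxy ⟨?_, hy⟩
      rw [sq]
      exact mul_dvd_mul (dvd_pow_self p (by omega)) (hp.dvd_of_dvd_pow h2)
    · have hry : ¬ p ∣ r * y := by
        intro hd
        rcases hp.dvd_or_dvd hd with hd | hd
        · exact hr' (pow_succ p v ▸ mul_dvd_mul_left _ hd)
        · exact hy hd
      -- With w inverse to ry modulo p^(E+1), the norm over p^(2v) becomes g(xw) up to a unit
      -- square.
      obtain ⟨u, w, huw⟩ := IsCoprime.pow_left (m := E + 1) (hp.coprime_iff_not_dvd.2 hry)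
      apply hg (x * w)
      have h5 : (x * w) ^ 2 + B * (x * w) - A =
          w ^ 2 * (x ^ 2 + B * x * (r * y) - A * (r * y) ^ 2) + p ^ (E + 1) *
            (u * (B * (x * w) - A * (1 + w * (r * y)))) := by
        linear_combination (-B * (x * w) + A * (1 + w * (r * y))) * huw
      rw [h5]
      exact (h1.mul_left _).add (dvd_mul_right _ _)
  -- If x has valuation s < v, the term x² dominates and the norm has valuation exactly 2s.
  · have hx0 : x ≠ 0 := fun h0 => hxv (h0 ▸ dvd_zero _)
    have hfin : FiniteMultiplicity p x := ⟨v, fun hd => hxv ((pow_dvd_pow p v.le_succ).trans hd)⟩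
    obtain ⟨u, hu, hpu⟩ := hfin.exists_eq_pow_mul_and_not_dvd
    set s := multiplicity p x
    have hsv : s < v := by
      by_contra! hd
      exact hxv ((pow_dvd_pow p hd).trans ⟨u, hu⟩)
    obtain ⟨d, rfl⟩ : ∃ d, v = s + 1 + d := ⟨v - (s + 1), by omega⟩
    apply hpu
    apply hp.dvd_of_dvd_pow (n := 2)
    have h1 : p ^ (2 * s) * p ∣ p ^ (2 * s) * (u ^ 2 + p * (p ^ d * r * B * u * y -
        p ^ (2 * d + 1) * r ^ 2 * A * y ^ 2)) := by
      rw [← pow_succ]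
      refine ((pow_dvd_pow p (show 2 * s + 1 ≤ 2 * (s + 1 + d) + E + 1 by omega)).trans h).trans
        (dvd_of_eq ?_)
      clear_value s
      subst hu
      ring
    have h2 := (mul_dvd_mul_iff_left (pow_ne_zero _ hp.ne_zero)).1 h1
    exact (dvd_add_left (dvd_mul_right _ _)).1 h2

theorem isNoetherianRing_quadraticAlgebra_int (a b : ℤ) :
    IsNoetherianRing (QuadraticAlgebra ℤ a b) :=
  IsNoetherianRing.of_finite ℤ _

theorem QuadraticAlgebra.hasAbsorbingFactorization {a b : ℤ} [IsDomain (QuadraticAlgebra ℤ a b)]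
    {k : ℕ} (hk : 1 ≤ k)
    (H : ∀ p : ℕ, p.Prime →
      (∀ c : ℤ, (p : ℤ) ^ 2 ∣ c ^ 2 + b * c - a → ¬ (p : ℤ) ∣ 2 * c + b) ∨
      (p : ℤ) ^ 2 ∣ a ∧ (p : ℤ) ∣ b ∧ ∀ x : QuadraticAlgebra ℤ a b, (p : ℤ) ∣ x.re →
        ¬ ((p : ℤ) ^ 2 ∣ x.re ∧ (p : ℤ) ∣ x.im) → ¬ (p : ℤ) ^ (k + 1) ∣ x.norm) :
    HasAbsorbingFactorization (QuadraticAlgebra ℤ a b) k := by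
  have := isNoetherianRing_quadraticAlgebra_int a b
  refine hasAbsorbingFactorization_of_exists_mul fun I hI hIk => ?_
  have hI0 : I ≠ ⊥ := by
    rintro rfl
    exact hIk (Ideal.IsPrime.isNAbsorbing Ideal.isPrime_bot hk)
  classical
  have hex : ∃ m : ℕ, m ≠ 0 ∧ algebraMap ℤ _ (m : ℤ) ∈ I := by
    obtain ⟨x, hx, hx0⟩ := Submodule.exists_mem_ne_zero_of_ne_bot hI0
    refine ⟨x.norm.natAbs, ?_, ?_⟩
    · have := norm_mem_nonZeroDivisors_iff.2 (mem_nonZeroDivisors_of_ne_zero hx0)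
      simpa using nonZeroDivisors.ne_zero this
    · rcases Int.natAbs_eq x.norm with h | h
      · rw [← h]
        exact algebraMap_norm_mem hx
      · rw [← neg_eq_iff_eq_neg.2 h, map_neg]
        exact I.neg_mem (algebraMap_norm_mem hx)
  set m := Nat.find hex with hm
  obtain ⟨hm0, hmI⟩ := Nat.find_spec hex
  have hmin : ∀ l : ℕ, l ≠ 0 → algebraMap ℤ _ (l : ℤ) ∈ I → m ≤ l := fun l h0 hl =>
    Nat.find_min' hex ⟨h0, hl⟩
  rw [← hm] at hm0 hmI
  have hm1 : m ≠ 1 := by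
    intro h
    rw [h] at hmI
    exact hI ((Ideal.eq_top_iff_one _).2 (by simpa using hmI))
  have hq : m.minFac.Prime := Nat.minFac_prime hm1
  set q := m.minFac with hqdef
  obtain ⟨e, m', hqm', hmm⟩ := Nat.exists_eq_pow_mul_and_not_dvd hm0 q hq.ne_one
  have hm'0 : m' ≠ 0 := fun h => hm0 (by rw [hmm, h, mul_zero])
  have he0 : e ≠ 0 := by
    rintro rfl
    rw [pow_zero, one_mul] at hmm
    exact hqm' (hmm ▸ m.minFac_dvd)
  have hqe : 1 < q ^ e := Nat.one_lt_pow he0 hq.one_lt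
  by_cases hm' : m' = 1
  swap
  -- Coprime splitting I = (I + (q^e))(I + (m')); minimality of m makes both factors strictly larger
  -- than I.
  · have hcop : IsCoprime ((q ^ e : ℕ) : ℤ) (m' : ℤ) :=
      Nat.isCoprime_iff_coprime.2 (Nat.Coprime.pow_left _ ((hq.coprime_iff_not_dvd).2 hqm'))
    refine ⟨I ⊔ Ideal.span {algebraMap ℤ _ ((q ^ e : ℕ) : ℤ)}, I ⊔ Ideal.span {algebraMap ℤ _ m'},
      ?_, ?_, le_antisymm ?_ ?_⟩
    · refine left_lt_sup.2 fun h => ?_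
      have := hmin _ (by omega) (h (Ideal.mem_span_singleton_self _))
      rw [hmm] at this
      have h2 : 2 ≤ m' := by omega
      nlinarith
    · refine left_lt_sup.2 fun h => ?_
      have := hmin _ hm'0 (h (Ideal.mem_span_singleton_self _))
      rw [hmm] at this
      have h2 : 1 ≤ m' := by omega
      nlinarith
    · rw [Ideal.sup_mul, Ideal.mul_sup, Ideal.mul_sup, Ideal.span_singleton_mul_span_singleton,
        ← map_mul, ← Nat.cast_mul, ← hmm]
      refine sup_le (sup_le Ideal.mul_le_left Ideal.mul_le_left) (sup_le Ideal.mul_le_right ?_)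
      rwa [Ideal.span_singleton_le_iff_mem]
    · intro x hx
      set L := (I ⊔ Ideal.span {algebraMap ℤ _ ((q ^ e : ℕ) : ℤ)}) *
        (I ⊔ Ideal.span {algebraMap ℤ _ (m' : ℤ)})
      obtain ⟨u, v, huv⟩ := hcop
      have : x = algebraMap ℤ _ u * (algebraMap ℤ _ ((q ^ e : ℕ) : ℤ) * x) +
          algebraMap ℤ _ v * (x * algebraMap ℤ _ (m' : ℤ)) := by
        have h1 := congrArg (algebraMap ℤ (QuadraticAlgebra ℤ a b)) huv
        simp only [map_add, map_mul, map_one] at h1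
        linear_combination -x * h1
      rw [this]
      exact L.add_mem
        (L.mul_mem_left _ (Ideal.mul_mem_mul (Ideal.mem_sup_right (Ideal.mem_span_singleton_self _))
          (Ideal.mem_sup_left hx)))
        (L.mul_mem_left _ (Ideal.mul_mem_mul (Ideal.mem_sup_left hx)
          (Ideal.mem_sup_right (Ideal.mem_span_singleton_self _))))
  have hp : Prime (q : ℤ) := Nat.prime_iff_prime_int.1 hq
  have hpS : algebraMap ℤ (QuadraticAlgebra ℤ a b) q ≠ 0 := by
    rw [Ne, map_eq_zero_iff _ algebraMap_injective]
    exact hp.ne_zero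
  have hqI : algebraMap ℤ _ ((q : ℤ) ^ e) ∈ I := by
    rw [hmm, hm', mul_one] at hmI
    exact_mod_cast hmI
  have hinv : ∀ M M' : Ideal (QuadraticAlgebra ℤ a b), M ≠ ⊤ →
      M * M' = Ideal.span {algebraMap ℤ _ (q : ℤ)} → I < M → ∃ J K, I < J ∧ I < K ∧ J * K = I := by
    intro M M' hM hMM hIM
    obtain ⟨K, hK, hK'⟩ := Ideal.exists_eq_mul_of_le_of_mul_eq_span hpS hM hMM hIM.le hI0
    exact ⟨M, K, hIM, hK, hK'⟩
  rcases H q hq with hmax | ⟨ha, hb, hbound⟩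
  · obtain ⟨M, hM, hIM⟩ := Ideal.exists_le_maximal I hI
    have hpM : algebraMap ℤ _ (q : ℤ) ∈ M :=
      hM.isPrime.mem_of_pow_mem e (by rw [← map_pow]; exact hIM hqI)
    obtain ⟨M', hMM⟩ := exists_mul_eq_span_algebraMap hp hmax hM.ne_top hpM
    refine hinv M M' hM.ne_top hMM (lt_of_le_of_ne hIM ?_)
    rintro rfl
    exact hIk (hM.isPrime.isNAbsorbing hk)
  · have hre : ∀ x ∈ I, (q : ℤ) ∣ x.re := fun x hx =>
      dvd_re_of_mem hp ((dvd_pow_self _ two_ne_zero).trans ha) hb hI hqI hx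
    -- The condition says I ⊆ qP. Then (q) splits off, and I ≠ (q) because q ∉ qP.
    by_cases hall : ∀ x ∈ I, (q : ℤ) ^ 2 ∣ x.re ∧ (q : ℤ) ∣ x.im
    · refine hinv (Ideal.span {algebraMap ℤ _ (q : ℤ)}) ⊤ ?_ (Ideal.mul_top _)
        (lt_of_le_of_ne ?_ ?_)
      · intro h
        have h1 : (1 : QuadraticAlgebra ℤ a b) ∈ Ideal.span {algebraMap ℤ _ (q : ℤ)} :=
          h ▸ Submodule.mem_top
        exact hp.not_dvd_one (algebraMap_dvd_iff.1 (Ideal.mem_span_singleton.1 h1)).1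
      · exact fun x hx => Ideal.mem_span_singleton.2
          (algebraMap_dvd_iff.2 ⟨hre x hx, (hall x hx).2⟩)
      · rintro h
        have h1 := (hall (algebraMap ℤ _ (q : ℤ)) (by rw [h]; exact Ideal.mem_span_singleton_self _)).1
        rw [algebraMap_re, sq] at h1
        have h2 : (q : ℤ) * q ∣ q * 1 := by rwa [mul_one]
        exact hp.not_dvd_one ((mul_dvd_mul_iff_left hp.ne_zero).1 h2)
    · push Not at hall
      obtain ⟨x, hx, hx'⟩ := hall
      exact absurd (isNAbsorbing_of_forall_mem hp ha hb hqI hk fun y hy =>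
        algebraMap_pow_mul_mem hp ha hb hqI hx (hre x hx)
          (hbound x (hre x hx) fun h => hx' h.1 h.2) hy) hIk

end QuadraticOrderUpper

/-! ### The concrete order ℤ[r ω_n] and its abstract model. -/

section QuadOrder

open QuadraticAlgebra

/-- The constant `A` in the relation `ω² = A + B ω` satisfied by `ω_n`. -/
def omegaConst (n : ℤ) : ℤ := if n % 4 = 1 then (n - 1) / 4 else n

/-- The coefficient `B` in the relation `ω² = A + B ω` satisfied by `ω_n`. -/
def omegaTrace (n : ℤ) : ℤ := if n % 4 = 1 then 1 else 0

theorem omegaTrace_sq_add (n : ℤ) : omegaTrace n ^ 2 + 4 * omegaConst n = quadDisc n := by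
  unfold omegaTrace omegaConst quadDisc
  split_ifs with h <;> omega

theorem omegaElt_mul_self (n : ℤ) :
    omegaElt n * omegaElt n = omegaConst n • 1 + omegaTrace n • omegaElt n := by
  unfold omegaElt omegaConst omegaTrace sqrtElt
  split_ifs with h
  · obtain ⟨m, rfl⟩ : ∃ m, n = 4 * m + 1 := ⟨n / 4, by omega⟩
    rw [show (4 * m + 1 - 1) / 4 = m by omega]
    ext <;> simp <;> ring
  · ext <;> simp

theorem omegaElt_im_ne_zero (n : ℤ) : (omegaElt n).im ≠ 0 := by
  unfold omegaElt sqrtElt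
  split_ifs <;> simp

/-- The embedding of the abstract quadratic order into `ℚ(√n)` with image `ℤ[r ω_n]`. -/
noncomputable def quadOrderHom (n : ℤ) (r : ℕ) :
    QuadraticAlgebra ℤ ((r : ℤ) ^ 2 * omegaConst n) (r * omegaTrace n) →ₐ[ℤ] QuadField n :=
  QuadraticAlgebra.lift ⟨(r : QuadField n) * omegaElt n, by
    rw [mul_mul_mul_comm, omegaElt_mul_self]
    simp only [zsmul_eq_mul]
    push_cast
    ring⟩

theorem quadOrderHom_apply (n : ℤ) (r : ℕ)
    (z : QuadraticAlgebra ℤ ((r : ℤ) ^ 2 * omegaConst n) (r * omegaTrace n)) :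
    quadOrderHom n r z = z.re • 1 + z.im • ((r : QuadField n) * omegaElt n) := rfl

theorem quadOrderHom_injective (n : ℤ) {r : ℕ} (hr : r ≠ 0) :
    Function.Injective (quadOrderHom n r) := by
  rw [injective_iff_map_eq_zero]
  intro z hz
  rw [quadOrderHom_apply] at hz
  have him := congrArg QuadraticAlgebra.im hz
  simp [omegaElt_im_ne_zero, hr] at him
  have hre := congrArg QuadraticAlgebra.re hz
  simp [him] at hre
  ext
  exacts [hre, him]

theorem quadOrderHom_range (n : ℤ) (r : ℕ) : (quadOrderHom n r).range = quadOrder n r := by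
  apply le_antisymm
  · rintro _ ⟨z, rfl⟩
    change quadOrderHom n r z ∈ _
    rw [quadOrderHom_apply]
    exact add_mem (Subalgebra.smul_mem _ (one_mem _) _)
      (Subalgebra.smul_mem _ (Algebra.self_mem_adjoin_singleton _ _) _)
  · rw [Algebra.adjoin_le_iff, Set.singleton_subset_iff]
    exact ⟨omega, by change quadOrderHom n r omega = _; rw [quadOrderHom_apply]; simp⟩

theorem AFdim_quadOrder (n : ℤ) {r : ℕ} (hr : r ≠ 0) : AFdim (quadOrder n r) =
    AFdim (QuadraticAlgebra ℤ ((r : ℤ) ^ 2 * omegaConst n) (r * omegaTrace n)) :=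
  (AFdim_congr ((AlgEquiv.ofInjective _ (quadOrderHom_injective n hr)).trans
    (Subalgebra.equivOfEq _ _ (quadOrderHom_range n r))).toRingEquiv).symm

theorem isDomain_quadOrder_model {n : ℤ} (hn : Squarefree n) (hn1 : n ≠ 1) {r : ℕ} (hr : r ≠ 0) :
    IsDomain (QuadraticAlgebra ℤ ((r : ℤ) ^ 2 * omegaConst n) (r * omegaTrace n)) := by
  have : Fact (∀ q : ℚ, q ^ 2 ≠ (n : ℚ) + 0 * q) := ⟨fun q hq => by
    have h1 : IsSquare (n : ℚ) := ⟨q, by linear_combination -hq⟩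
    obtain ⟨t, ht⟩ := Rat.isSquare_intCast_iff.1 h1
    rcases Int.isUnit_iff.1 (hn t ⟨1, by rw [ht, mul_one]⟩) with rfl | rfl
    exacts [hn1 (by simpa using ht), hn1 (by simpa using ht)]⟩
  exact (quadOrderHom_injective n hr).isDomain (quadOrderHom n r)

/-! ### Roots of g modulo prime powers and the Kronecker symbol. -/

theorem four_mul_norm_omega_add (n z : ℤ) :
    4 * (z ^ 2 + omegaTrace n * z - omegaConst n) = (2 * z + omegaTrace n) ^ 2 - quadDisc n := by
  rw [← omegaTrace_sq_add]
  ring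

/-- The ring of integers `ℤ[ω_n]` is maximal at every prime. -/
theorem not_dvd_of_sq_dvd_norm_omega_add {n : ℤ} (hn : Squarefree n) {p : ℤ} (hp : Prime p) {z : ℤ}
    (h : p ^ 2 ∣ z ^ 2 + omegaTrace n * z - omegaConst n) : ¬ p ∣ 2 * z + omegaTrace n := by
  intro hz
  have hpn : ¬ p ^ 2 ∣ n := fun hd => hp.not_isUnit (hn p (sq p ▸ hd))
  by_cases h4 : n % 4 = 1
  · apply hpn
    have h1 := (pow_dvd_pow_of_dvd hz 2).sub (h.mul_left 4)
    rw [four_mul_norm_omega_add, sub_sub_cancel] at h1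
    simpa [quadDisc, h4] using h1
  · simp only [omegaTrace, omegaConst, h4, if_false, zero_mul, add_zero] at h hz
    by_cases hpz : p ∣ z
    · exact hpn ((dvd_sub_right (pow_dvd_pow_of_dvd hpz 2)).1 h)
    -- Here p is 2 up to sign and z is odd, so n ≡ z² ≡ 1 modulo 4.
    have hp2 : p ∣ 2 := (hp.dvd_or_dvd hz).resolve_right hpz
    have hp2' : Associated p 2 := hp.associated_of_dvd Int.prime_two hp2
    have h2z : ¬ (2 : ℤ) ∣ z := fun hd => hpz (hp2.trans hd)
    have h22 : (2 : ℤ) ^ 2 ∣ z ^ 2 - n := (hp2'.pow_pow (n := 2)).dvd_iff_dvd_left.1 h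
    obtain ⟨m, rfl⟩ : ∃ m, z = 2 * m + 1 := ⟨z / 2, by omega⟩
    obtain ⟨l, hl⟩ := h22
    apply h4
    have : n = 4 * (m ^ 2 + m - l) + 1 := by linear_combination -hl
    omega

/-- Since r is invertible modulo p², replacing c by c/r reduces to maximality of ℤ[ω_n]. -/
theorem not_dvd_of_sq_dvd_norm_mul_omega_add {n : ℤ} (hn : Squarefree n) {p r : ℤ} (hp : Prime p)
    (hr : ¬ p ∣ r) {c : ℤ}
    (h : p ^ 2 ∣ c ^ 2 + r * omegaTrace n * c - r ^ 2 * omegaConst n) :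
    ¬ p ∣ 2 * c + r * omegaTrace n := by
  intro hc
  obtain ⟨u, w, huw⟩ := IsCoprime.pow_left (m := 2) (hp.coprime_iff_not_dvd.2 hr)
  set A := omegaConst n with hA
  set B := omegaTrace n with hB
  apply not_dvd_of_sq_dvd_norm_omega_add hn hp (z := w * c)
  · rw [← hA, ← hB]
    have : (w * c) ^ 2 + B * (w * c) - A = w ^ 2 * (c ^ 2 + r * B * c - r ^ 2 * A) +
        p ^ 2 * (u * (B * (w * c) - A * (1 + w * r))) := by
      linear_combination (-B * (w * c) + A * (1 + w * r)) * huw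
    rw [this]
    exact (h.mul_left _).add (dvd_mul_right _ _)
  · rw [← hB]
    have : 2 * (w * c) + B = w * (2 * c + r * B) + p * (p * u * B) := by
      linear_combination -B * huw
    rw [this]
    exact (hc.mul_left _).add (dvd_mul_right _ _)

theorem kroneckerSymbol_trichotomy (a : ℤ) (p : ℕ) :
    kroneckerSymbol a p = 1 ∨ kroneckerSymbol a p = 0 ∨ kroneckerSymbol a p = -1 := by
  unfold kroneckerSymbol
  split_ifs <;> simp

theorem kroneckerSymbol_two_eq_one {a : ℤ} (h : kroneckerSymbol a 2 = 1) :
    a % 8 = 1 ∨ a % 8 = 7 := by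
  unfold kroneckerSymbol at h
  split_ifs at h <;> simp_all

theorem kroneckerSymbol_two_eq_zero {a : ℤ} (h : kroneckerSymbol a 2 = 0) : a % 2 = 0 := by
  unfold kroneckerSymbol at h
  split_ifs at h <;> simp_all

theorem kroneckerSymbol_two_eq_neg_one {a : ℤ} (h : kroneckerSymbol a 2 = -1) :
    a % 8 = 3 ∨ a % 8 = 5 := by
  unfold kroneckerSymbol at h
  split_ifs at h
  all_goals simp_all
  omega

theorem kroneckerSymbol_odd_eq_one {a : ℤ} {p : ℕ} (hp : p ≠ 2) (h : kroneckerSymbol a p = 1) :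
    ¬ (p : ℤ) ∣ a ∧ ∃ x : ℤ, x ^ 2 ≡ a [ZMOD p] := by
  unfold kroneckerSymbol at h
  split_ifs at h <;> simp_all

theorem kroneckerSymbol_odd_eq_zero {a : ℤ} {p : ℕ} (hp : p ≠ 2) (h : kroneckerSymbol a p = 0) :
    (p : ℤ) ∣ a := by
  unfold kroneckerSymbol at h
  split_ifs at h <;> simp_all

theorem kroneckerSymbol_odd_eq_neg_one {a : ℤ} {p : ℕ} (hp : p ≠ 2)
    (h : kroneckerSymbol a p = -1) : ¬ ∃ x : ℤ, x ^ 2 ≡ a [ZMOD p] := by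
  unfold kroneckerSymbol at h
  split_ifs at h <;> simp_all

theorem exists_dvd_norm_omega_add_of_sq_modEq {n x : ℤ} {p : ℕ} (hp : p.Prime) (hp2 : p ≠ 2)
    (hx : x ^ 2 ≡ quadDisc n [ZMOD p]) :
    ∃ z : ℤ, (p : ℤ) ∣ z ^ 2 + omegaTrace n * z - omegaConst n ∧
      (p : ℤ) ∣ 2 * z + omegaTrace n - x := by
  obtain ⟨h, hh⟩ := hp.odd_of_ne_two hp2
  set B := omegaTrace n with hB
  have hz : (p : ℤ) ∣ 2 * ((h + 1) * (x - B)) + B - x := ⟨x - B, by rw [hh]; push_cast; ring⟩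
  -- As p = 2h + 1, the factor h + 1 inverts 2 modulo p, so z solves 2z + B ≡ x.
  refine ⟨(h + 1) * (x - B), ?_, hz⟩
  have hcop : IsCoprime (p : ℤ) 4 := by
    have : Nat.Coprime p 4 := ((Nat.coprime_primes hp Nat.prime_two).2 hp2).pow_right 2
    exact_mod_cast Nat.isCoprime_iff_coprime.2 this
  refine hcop.dvd_of_dvd_mul_left ?_
  rw [four_mul_norm_omega_add, ← hB]
  have h1 := hx.symm.dvd
  have := (hz.mul_left (2 * ((h + 1) * (x - B)) + B + x)).add h1
  refine this.trans (dvd_of_eq ?_)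
  ring

theorem exists_dvd_norm_omega_add_of_kroneckerSymbol_eq_one {n : ℤ} {p : ℕ} (hp : p.Prime)
    (h : kroneckerSymbol (quadDisc n) p = 1) :
    ∃ z : ℤ, (p : ℤ) ∣ z ^ 2 + omegaTrace n * z - omegaConst n ∧
      ¬ (p : ℤ) ∣ 2 * z + omegaTrace n := by
  by_cases hp2 : p = 2
  · subst hp2
    have h1 := kroneckerSymbol_two_eq_one h
    -- Here n ≡ 1 modulo 8, so A is even and B = 1: zero is a simple root.
    refine ⟨0, ?_⟩
    unfold quadDisc at *
    unfold omegaTrace omegaConst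
    split_ifs at * with h4
    · simp only [Nat.cast_ofNat]
      constructor <;> omega
    · omega
  · obtain ⟨h1, x, hx⟩ := kroneckerSymbol_odd_eq_one hp2 h
    obtain ⟨z, hz, hz'⟩ := exists_dvd_norm_omega_add_of_sq_modEq hp hp2 hx
    refine ⟨z, hz, fun hd => h1 ?_⟩
    exact (Int.ModEq.dvd_iff hx).1 (((dvd_sub_right hd).1 hz').pow two_ne_zero)

theorem exists_dvd_norm_omega_add_of_kroneckerSymbol_eq_zero {n : ℤ} {p : ℕ} (hp : p.Prime)
    (h : kroneckerSymbol (quadDisc n) p = 0) :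
    ∃ z : ℤ, (p : ℤ) ∣ z ^ 2 + omegaTrace n * z - omegaConst n := by
  by_cases hp2 : p = 2
  · subst hp2
    have h1 := kroneckerSymbol_two_eq_zero h
    have h4 : ¬ n % 4 = 1 := by
      intro h4
      simp only [quadDisc, h4, if_true] at h1
      omega
    refine ⟨n, ?_⟩
    simp only [omegaTrace, omegaConst, h4, if_false]
    have := (Int.even_mul_pred_self n).two_dvd
    rw [show n ^ 2 + 0 * n - n = n * (n - 1) by ring]
    exact_mod_cast this
  · obtain ⟨z, hz, -⟩ := exists_dvd_norm_omega_add_of_sq_modEq (x := 0) hp hp2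
      (by simpa [Int.modEq_iff_dvd] using kroneckerSymbol_odd_eq_zero hp2 h)
    exact ⟨z, hz⟩

theorem not_dvd_norm_omega_add_of_kroneckerSymbol_eq_neg_one {n : ℤ} {p : ℕ}
    (h : kroneckerSymbol (quadDisc n) p = -1) (z : ℤ) :
    ¬ (p : ℤ) ∣ z ^ 2 + omegaTrace n * z - omegaConst n := by
  intro hz
  by_cases hp2 : p = 2
  · subst hp2
    have h1 := kroneckerSymbol_two_eq_neg_one h
    unfold quadDisc at *
    unfold omegaTrace omegaConst at hz
    split_ifs at * with h4
    -- Here n ≡ 5 modulo 8, so A is odd while z(z + 1) is even.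
    · have h2 := (Int.even_mul_succ_self z).two_dvd
      rw [show z ^ 2 + 1 * z - (n - 1) / 4 = z * (z + 1) - (n - 1) / 4 by ring] at hz
      generalize z * (z + 1) = w at *
      push_cast at hz
      omega
    · omega
  · refine kroneckerSymbol_odd_eq_neg_one hp2 h ⟨2 * z + omegaTrace n, (Int.modEq_iff_dvd.2 ?_).symm⟩
    rw [← four_mul_norm_omega_add]
    exact hz.mul_left 4

/-- In the ramified case p divides g'(z) at every root z modulo p, so p² ∣ g(z) would contradict
maximality. -/
theorem not_sq_dvd_norm_omega_add_of_kroneckerSymbol_eq_zero {n : ℤ} (hn : Squarefree n) {p : ℕ}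
    (hp : p.Prime) (h : kroneckerSymbol (quadDisc n) p = 0) (z : ℤ) :
    ¬ (p : ℤ) ^ 2 ∣ z ^ 2 + omegaTrace n * z - omegaConst n := by
  intro hz
  have hp' := Nat.prime_iff_prime_int.1 hp
  apply not_dvd_of_sq_dvd_norm_omega_add hn hp' hz
  by_cases hp2 : p = 2
  · subst hp2
    have h1 := kroneckerSymbol_two_eq_zero h
    have h4 : ¬ n % 4 = 1 := by
      intro h4
      simp only [quadDisc, h4, if_true] at h1
      omega
    simp [omegaTrace, h4]
  · apply hp'.dvd_of_dvd_pow (n := 2)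
    have := four_mul_norm_omega_add n z
    rw [eq_sub_iff_add_eq] at this
    rw [← this]
    exact (((dvd_pow_self _ two_ne_zero).trans hz).mul_left _).add
      (kroneckerSymbol_odd_eq_zero hp2 h)

/-- A simple root modulo `p` lifts to a root modulo every power of `p`. -/
theorem exists_pow_dvd_of_dvd_of_not_dvd {A B p : ℤ} (hp : Prime p) {z : ℤ}
    (h : p ∣ z ^ 2 + B * z - A) (hz : ¬ p ∣ 2 * z + B) (K : ℕ) :
    ∃ z : ℤ, p ^ (K + 1) ∣ z ^ 2 + B * z - A ∧ ¬ p ∣ 2 * z + B := by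
  induction K with
  | zero => exact ⟨z, by simpa using h, hz⟩
  | succ K ih =>
    obtain ⟨y, ⟨c, hc⟩, hy⟩ := ih
    obtain ⟨u, v, huv⟩ := hp.coprime_iff_not_dvd.2 hy
    -- Newton step: v is the inverse of g'(y) = 2y + B modulo p.
    refine ⟨y - p ^ (K + 1) * (v * c), ⟨u * c + p ^ K * (v * c) ^ 2, ?_⟩, fun hd => hy ?_⟩
    · linear_combination hc - p ^ (K + 1) * c * huv
    · have := hd.add (Dvd.intro (2 * p ^ K * (v * c)) rfl : p ∣ p * (2 * p ^ K * (v * c)))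
      refine this.trans (dvd_of_eq ?_)
      ring

/-! ### Valuations of norms and the two bounds for the order. -/

theorem le_of_hasAbsorbingFactorization_of_pow_dvd {A B : ℤ} {r p : ℕ} (hp : p ∈ r.primeFactors)
    {k : ℕ} (hk : HasAbsorbingFactorization (QuadraticAlgebra ℤ ((r : ℤ) ^ 2 * A) (r * B)) k)
    {e : ℕ} {z : ℤ} (hz : (p : ℤ) ^ e ∣ z ^ 2 + B * z - A) :
    2 * r.factorization p + e ≤ k := by
  have hp' := Nat.prime_iff_prime_int.1 (Nat.prime_of_mem_primeFactors hp)
  have hpr : (p : ℤ) ∣ r := Int.natCast_dvd_natCast.2 (Nat.dvd_of_mem_primeFactors hp)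
  have hpr' : (p : ℤ) ^ r.factorization p ∣ r := by
    exact_mod_cast Nat.ordProj_dvd r p
  -- The test element r(z + ω) has imaginary part 1 in the model and norm r²g(z).
  refine QuadraticAlgebra.le_of_hasAbsorbingFactorization hp'
    ((pow_dvd_pow_of_dvd hpr 2).mul_right _) (hpr.mul_right _) hk (x := ⟨r * z, 1⟩)
    (hpr.mul_right _) hp'.not_dvd_one ?_
  have : norm (⟨r * z, 1⟩ : QuadraticAlgebra ℤ ((r : ℤ) ^ 2 * A) (r * B)) =
      r ^ 2 * (z ^ 2 + B * z - A) := by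
    rw [norm_def]
    ring
  rw [this, pow_add, mul_comm 2, pow_mul]
  exact mul_dvd_mul (pow_dvd_pow_of_dvd hpr' 2) hz

theorem not_pow_dvd_norm_of_forall_not_dvd {A B : ℤ} {r p : ℕ} (hr : r ≠ 0)
    (hp : p ∈ r.primeFactors) {E k : ℕ} (hk : 2 * r.factorization p + E ≤ k)
    (hg : ∀ z : ℤ, ¬ (p : ℤ) ^ (E + 1) ∣ z ^ 2 + B * z - A)
    (x : QuadraticAlgebra ℤ ((r : ℤ) ^ 2 * A) (r * B)) (hx : (p : ℤ) ∣ x.re)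
    (hx' : ¬ ((p : ℤ) ^ 2 ∣ x.re ∧ (p : ℤ) ∣ x.im)) : ¬ (p : ℤ) ^ (k + 1) ∣ x.norm := by
  have hpp := Nat.prime_of_mem_primeFactors hp
  intro h
  refine not_pow_dvd_of_forall_not_dvd (r := r) (Nat.prime_iff_prime_int.1 hpp)
    (hpp.factorization_pos_of_dvd hr (Nat.dvd_of_mem_primeFactors hp)) ?_ ?_ hg hx hx' ?_
  · exact_mod_cast Nat.ordProj_dvd r p
  · exact_mod_cast Nat.pow_succ_factorization_not_dvd hr hpp
  · refine (pow_dvd_pow _ (show _ ≤ k + 1 by omega)).trans (h.trans (dvd_of_eq ?_))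
    rw [norm_def]
    ring

/-- The maximum in the formula for `AFdim ℤ[r ω_n]`. -/
noncomputable def quadOrderBound (n : ℤ) (r : ℕ) : ℕ :=
  max
    ((r.primeFactors.filter (fun p => kroneckerSymbol (quadDisc n) p = 0)).sup
      (fun p => 2 * r.factorization p + 1))
    ((r.primeFactors.filter (fun p => kroneckerSymbol (quadDisc n) p = -1)).sup
      (fun p => 2 * r.factorization p))

theorem le_quadOrderBound_of_eq_zero {n : ℤ} {r p : ℕ} (hp : p ∈ r.primeFactors)
    (h : kroneckerSymbol (quadDisc n) p = 0) : 2 * r.factorization p + 1 ≤ quadOrderBound n r :=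
  le_max_of_le_left (Finset.le_sup (f := fun p => 2 * r.factorization p + 1)
    (Finset.mem_filter.2 ⟨hp, h⟩))

theorem le_quadOrderBound_of_eq_neg_one {n : ℤ} {r p : ℕ} (hp : p ∈ r.primeFactors)
    (h : kroneckerSymbol (quadDisc n) p = -1) : 2 * r.factorization p ≤ quadOrderBound n r :=
  le_max_of_le_right (Finset.le_sup (f := fun p => 2 * r.factorization p)
    (Finset.mem_filter.2 ⟨hp, h⟩))

theorem one_le_quadOrderBound {n : ℤ} {r : ℕ} (hr : 1 < r)
    (h : ∀ p ∈ r.primeFactors, kroneckerSymbol (quadDisc n) p ≠ 1) : 1 ≤ quadOrderBound n r := by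
  obtain ⟨p, hp⟩ := Nat.nonempty_primeFactors.2 hr
  have hpos : 0 < r.factorization p := (Nat.prime_of_mem_primeFactors hp).factorization_pos_of_dvd
    (by omega) (Nat.dvd_of_mem_primeFactors hp)
  rcases kroneckerSymbol_trichotomy (quadDisc n) p with h1 | h1 | h1
  · exact absurd h1 (h p hp)
  · have := le_quadOrderBound_of_eq_zero hp h1
    omega
  · have := le_quadOrderBound_of_eq_neg_one hp h1
    omega

theorem hasAbsorbingFactorization_quadOrderBound {n : ℤ} (hn : Squarefree n) (hn1 : n ≠ 1) {r : ℕ}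
    (hr : 1 < r) (h : ∀ p ∈ r.primeFactors, kroneckerSymbol (quadDisc n) p ≠ 1) :
    HasAbsorbingFactorization
      (QuadraticAlgebra ℤ ((r : ℤ) ^ 2 * omegaConst n) (r * omegaTrace n))
      (quadOrderBound n r) := by
  have hr0 : r ≠ 0 := by omega
  have := isDomain_quadOrder_model hn hn1 hr0
  refine QuadraticAlgebra.hasAbsorbingFactorization (one_le_quadOrderBound hr h) fun p hp => ?_
  by_cases hpr : p ∣ r
  · have hpr' : (p : ℤ) ∣ r := Int.natCast_dvd_natCast.2 hpr
    refine .inr ⟨(pow_dvd_pow_of_dvd hpr' 2).mul_right _, hpr'.mul_right _, ?_⟩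
    have hpm : p ∈ r.primeFactors := Nat.mem_primeFactors.2 ⟨hp, hpr, hr0⟩
    rcases kroneckerSymbol_trichotomy (quadDisc n) p with h1 | h1 | h1
    · exact absurd h1 (h p hpm)
    · exact not_pow_dvd_norm_of_forall_not_dvd hr0 hpm (le_quadOrderBound_of_eq_zero hpm h1)
        (not_sq_dvd_norm_omega_add_of_kroneckerSymbol_eq_zero hn hp h1)
    · refine not_pow_dvd_norm_of_forall_not_dvd (E := 0) hr0 hpm
        (le_quadOrderBound_of_eq_neg_one hpm h1) ?_
      simpa using not_dvd_norm_omega_add_of_kroneckerSymbol_eq_neg_one h1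
  · exact .inl fun c => not_dvd_of_sq_dvd_norm_mul_omega_add hn (Nat.prime_iff_prime_int.1 hp)
      (fun hd => hpr (Int.natCast_dvd_natCast.1 hd))

theorem quadOrderBound_le {n : ℤ} {r k : ℕ}
    (hk : HasAbsorbingFactorization
      (QuadraticAlgebra ℤ ((r : ℤ) ^ 2 * omegaConst n) (r * omegaTrace n)) k) :
    quadOrderBound n r ≤ k := by
  refine max_le (Finset.sup_le fun p hp => ?_) (Finset.sup_le fun p hp => ?_)
  · obtain ⟨hp, h⟩ := Finset.mem_filter.1 hp
    obtain ⟨z, hz⟩ := exists_dvd_norm_omega_add_of_kroneckerSymbol_eq_zero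
      (Nat.prime_of_mem_primeFactors hp) h
    exact le_of_hasAbsorbingFactorization_of_pow_dvd hp hk (e := 1) (by simpa using hz)
  · obtain ⟨hp, h⟩ := Finset.mem_filter.1 hp
    exact le_of_hasAbsorbingFactorization_of_pow_dvd hp hk (e := 0) (z := 0) (by simp)

/-- In the split case Hensel lifting makes v_p(g(z)) arbitrarily large; valuation k + 1 already
contradicts the lower bound. -/
theorem kroneckerSymbol_ne_one_of_hasAbsorbingFactorization {n : ℤ} {r k : ℕ}
    (hk : HasAbsorbingFactorization
      (QuadraticAlgebra ℤ ((r : ℤ) ^ 2 * omegaConst n) (r * omegaTrace n)) k)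
    {p : ℕ} (hp : p ∈ r.primeFactors) : kroneckerSymbol (quadDisc n) p ≠ 1 := by
  intro h
  have hpp := Nat.prime_of_mem_primeFactors hp
  obtain ⟨z, hz, hz'⟩ := exists_dvd_norm_omega_add_of_kroneckerSymbol_eq_one hpp h
  obtain ⟨y, hy, -⟩ := exists_pow_dvd_of_dvd_of_not_dvd (Nat.prime_iff_prime_int.1 hpp) hz hz' k
  have := le_of_hasAbsorbingFactorization_of_pow_dvd hp hk hy
  omega

end QuadOrder

theorem theorem4p13 (n : ℤ) (hn : Squarefree n) (hn1 : n ≠ 1) (r : ℕ) (hr : 1 < r) :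
    (AFdim (quadOrder n r) < ⊤ ↔
      ∀ p ∈ r.primeFactors, kroneckerSymbol (quadDisc n) p ≠ 1) ∧
    (AFdim (quadOrder n r) < ⊤ →
      AFdim (quadOrder n r) =
        ((max
          ((r.primeFactors.filter (fun p => kroneckerSymbol (quadDisc n) p = 0)).sup
            (fun p => 2 * r.factorization p + 1))
          ((r.primeFactors.filter (fun p => kroneckerSymbol (quadDisc n) p = -1)).sup
            (fun p => 2 * r.factorization p)) : ℕ) : ℕ∞)) := by
  rw [AFdim_quadOrder n (by omega : r ≠ 0)]
  have hne : AFdim (QuadraticAlgebra ℤ ((r : ℤ) ^ 2 * omegaConst n) (r * omegaTrace n)) < ⊤ →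
      ∀ p ∈ r.primeFactors, kroneckerSymbol (quadDisc n) p ≠ 1 := by
    intro h p hp
    simp only [AFdim, iInf_lt_iff] at h
    obtain ⟨k, ⟨-, hk⟩, -⟩ := h
    exact kroneckerSymbol_ne_one_of_hasAbsorbingFactorization hk hp
  have heq : (∀ p ∈ r.primeFactors, kroneckerSymbol (quadDisc n) p ≠ 1) →
      AFdim (QuadraticAlgebra ℤ ((r : ℤ) ^ 2 * omegaConst n) (r * omegaTrace n)) =
        (quadOrderBound n r : ℕ∞) := by
    intro h
    apply le_antisymm
    · exact iInf₂_le _ ⟨one_le_quadOrderBound hr h,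
        hasAbsorbingFactorization_quadOrderBound hn hn1 hr h⟩
    · exact le_iInf₂ fun k hk => Nat.cast_le.2 (quadOrderBound_le hk.2)
  exact ⟨⟨hne, fun h => heq h ▸ ENat.natCast_lt_top _⟩, fun h => heq (hne h)⟩
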